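/- **Lemma 3.2.** Let $N\in\mathbb N$ and let $p,q,r\in\mathbb R$ satisfy $2\le q\le p<N$ and $pr>N$. Write $m^*=Nm/(N-m)$ for $m\in\{p,q\}$ and $r'=r/(r-1)$. Let $D^{1,m}(\mathbb R^N)$ be the space of all $u\in L^{m^*}(\mathbb R^N)$ with weak gradient $\nabla u\in L^m(\mathbb R^N)$, and let $S_m$ be the best constant in the Sobolev inequality $\|u\|_{L^{m^*}}^m\le S_m\int_{\mathbb R^N}|\nabla u|^m\,dx$ $(u\in D^{1,m}(\mathbb R^N))$; put $S=\max\{S_p,S_q\}$. Let $a,b:\mathbb R^N\to[0,\infty)$ be continuous and $$E=\Big\{u\in D^{1,p}(\mathbb R^N)\cap D^{1,q}(\mathbb R^N):\ \int_{\mathbb R^N}a|u|^p\,dx<\infty,\ \int_{\mathbb R^N}b|u|^q\,dx<\infty\Big\}.$$ Let $H:\mathbb R^N\times\mathbb R\to\mathbb R$ be continuous with $|H(x,s)|\le h(x)|s|^{p-1}$ for all $x\in\mathbb R^N$ and $s\in\mathbb R$, where $h\in L^r(\mathbb R^N)$, and let $A,B:\mathbb R^N\to[0,\infty)$. Let $v\in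 E$ be a weak solution of $$-\Delta_p v-\Delta_q v+A(x)|v|^{p-2}v+B(x)|v|^{q-2}v=H(x,v)\quad\text{in }\mathbb R^N,$$ that is, for every $\phi\in E$ the functions $A|v|^{p-2}v\phi$, $B|v|^{q-2}v\phi$, $H(\cdot,v)\phi$ are integrable and $$\int|\nabla v|^{p-2}\nabla v\cdot\nabla\phi+\int|\nabla v|^{q-2}\nabla v\cdot\nabla\phi+\int A|v|^{p-2}v\phi+\int B|v|^{q-2}v\phi=\int H(x,v)\phi .$$ Put $\sigma=p^*/(pr')>1$, $C_1=(4S\|h\|_{L^r})^{1/p}$, $$K=\begin{cases}\big(C_1^{1/(\sigma-1)}\sigma^{\sigma/(\sigma-1)^2}\big)^{-1}&\text{if }C_1\le1,\\ \big(C_1^{1/\sigma}\sigma^{1/\sigma}\big)^{-1}&\text{if }C_1>1,\end{cases}\qquad L_v=\begin{cases}1&\text{if }\|v\|_{L^{pr'}}\le1,\\ \|v\|_{L^{pr'}}^{1/(\sigma-1)}&\text{if }\|v\|_{L^{pr'}}>1,\end{cases}$$ with $K=0$ if $\|h\|_{L^r}=0$, and $L_v=\infty$ if $v\notin L^{pr'}(\mathbb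 R^N)$ (so that the right-hand side below is then $\infty$ if $K>0$, and $K L_v=0$ if $K=0$). Then $v\in L^\infty(\mathbb R^N)$ and $$\|v\|_{L^\infty(\mathbb R^N)}\le M_1\max\{\|v\|_{L^{p^*}(\mathbb R^N)},\,K,\,K L_v,\,1\},$$ where $M_1>0$ depends only on $N,p,q,r$ and $\|h\|_{L^r(\mathbb R^N)}$ (in particular not on $A$, $B$, $a$, $b$, nor on $H$, $h$ or $v$ otherwise). -/

import Mathlib

open MeasureTheory
open scoped ContDiff ENNReal

noncomputable section

namespace PQLaplace

/-- The space `ℝ^N` with its Euclidean norm and Lebesgue measure. -/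
abbrev Space (N : ℕ) : Type := EuclideanSpace ℝ (Fin N)

/-- `g` is the weak gradient of `u` on `ℝ^N`: both are locally integrable and
`∫ u ∂ᵢφ = - ∫ gᵢ φ` for every smooth compactly supported `φ` and every coordinate `i`. -/
def HasWeakGrad {N : ℕ} (u : Space N → ℝ) (g : Space N → Space N) : Prop :=
  LocallyIntegrable u volume ∧ LocallyIntegrable g volume ∧
    ∀ φ : Space N → ℝ, ContDiff ℝ ∞ φ → HasCompactSupport φ → ∀ i : Fin N,
      ∫ x, u x * fderiv ℝ φ x (EuclideanSpace.single i 1) = - ∫ x, g x i * φ x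

/-- The critical Sobolev exponent `m* = N m / (N - m)`. -/
def critExp (N : ℕ) (m : ℝ) : ℝ := N * m / (N - m)

/-- The `L^t(ℝ^N)` norm, for a real exponent `t`, with values in `[0, ∞]`. -/
def lpNorm {N : ℕ} (u : Space N → ℝ) (t : ℝ) : ℝ≥0∞ := eLpNorm u (ENNReal.ofReal t) volume

/-- The space `D^{1,m}(ℝ^N)`: functions in `L^{m*}` whose weak gradient is in `L^m`. -/
def MemD {N : ℕ} (m : ℝ) (u : Space N → ℝ) : Prop :=
  MemLp u (ENNReal.ofReal (critExp N m)) volume ∧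
    ∃ g : Space N → Space N, HasWeakGrad u g ∧ MemLp g (ENNReal.ofReal m) volume

/-- The space `E`: functions in `D^{1,p} ∩ D^{1,q}` with `∫ a |u|^p < ∞` and `∫ b |u|^q < ∞`. -/
def MemE {N : ℕ} (p q : ℝ) (a b : Space N → ℝ) (u : Space N → ℝ) : Prop :=
  MemD p u ∧ MemD q u ∧
    Integrable (fun x => a x * |u x| ^ p) volume ∧
    Integrable (fun x => b x * |u x| ^ q) volume

/-- `v ∈ E` is a weak solution of
`-Δ_p v - Δ_q v + A |v|^{p-2} v + B |v|^{q-2} v = H(x, v)` on `ℝ^N`, tested against every `φ ∈ E`;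
the zero-order integrals are required to exist. (The two gradient integrals always exist, by
Hölder's inequality; weak gradients are unique up to null sets.) -/
def IsWeakSolution {N : ℕ} (p q : ℝ) (a b A B : Space N → ℝ) (H : Space N → ℝ → ℝ)
    (v : Space N → ℝ) : Prop :=
  MemE p q a b v ∧
    ∀ φ : Space N → ℝ, MemE p q a b φ →
      Integrable (fun x => A x * (|v x| ^ (p - 2) * v x) * φ x) volume ∧
      Integrable (fun x => B x * (|v x| ^ (q - 2) * v x) * φ x) volume ∧
      Integrable (fun x => H x (v x) * φ x) volume ∧
      ∀ gv gφ : Space N → Space N, HasWeakGrad v gv → HasWeakGrad φ gφ →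
        (∫ x, ‖gv x‖ ^ (p - 2) * inner ℝ (gv x) (gφ x))
          + (∫ x, ‖gv x‖ ^ (q - 2) * inner ℝ (gv x) (gφ x))
          + (∫ x, A x * (|v x| ^ (p - 2) * v x) * φ x)
          + (∫ x, B x * (|v x| ^ (q - 2) * v x) * φ x)
          = ∫ x, H x (v x) * φ x

/-- The (best) Sobolev constant `S_m`: the least `S ≥ 0` such that
`‖u‖_{L^{m*}}^m ≤ S ∫ |∇u|^m` for every `u ∈ D^{1,m}(ℝ^N)`. -/
def sobolevConst (N : ℕ) (m : ℝ) : ℝ :=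
  sInf {S : ℝ | 0 ≤ S ∧ ∀ (u : Space N → ℝ) (g : Space N → Space N),
    MemD m u → HasWeakGrad u g →
      (lpNorm u (critExp N m)).toReal ^ m ≤ S * ∫ x, ‖g x‖ ^ m}

/-- The conjugate exponent `r' = r / (r - 1)`. -/
def conjExp (r : ℝ) : ℝ := r / (r - 1)

/-- `σ = p* / (p r')`. -/
def sigma (N : ℕ) (p r : ℝ) : ℝ := critExp N p / (p * conjExp r)

/-- `C₁ = (4 S η)^{1/p}` with `S = max {S_p, S_q}`; here `η` stands for `‖h‖_{L^r}`. -/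
def constC (N : ℕ) (p q η : ℝ) : ℝ :=
  (4 * max (sobolevConst N p) (sobolevConst N q) * η) ^ (1 / p)

/-- The constant `K`; here `η` stands for `‖h‖_{L^r}`. -/
def constK (N : ℕ) (p q r η : ℝ) : ℝ :=
  if constC N p q η ≤ 1 then
    (constC N p q η ^ (1 / (sigma N p r - 1)) *
      sigma N p r ^ (sigma N p r / (sigma N p r - 1) ^ 2))⁻¹
  else
    (constC N p q η ^ (1 / sigma N p r) * sigma N p r ^ (1 / sigma N p r))⁻¹

/-- The quantity `L_v`, with values in `[1, ∞]`. -/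
def constL {N : ℕ} (p r : ℝ) (v : Space N → ℝ) : ℝ≥0∞ :=
  if lpNorm v (p * conjExp r) ≤ 1 then 1
  else lpNorm v (p * conjExp r) ^ (1 / (sigma N p r - 1))

end PQLaplace

end

/-! The proof is a Moser iteration. Testing the equation with an odd function of `v` whose
derivative is min(|v|, k)^(p(s-1)) makes the q-gradient term and both zero-order terms nonnegative.
They are dropped, leaving ∫ min(|v|, k)^(p(s-1)) |∇v|^p ≤ ∫ |h| |v|^(ps)
(`IsWeakSolution.integral_truncPow_mul_le`). The left side is the L^p energy of a truncation of
|v|^s / s. The Sobolev inequality, Hölder with exponents r and r', and Fatou as k → ∞ then give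
‖v‖_{p* s} ≤ (s C ‖h‖_r^(1/p))^(1/s) ‖v‖_{p r' s} (`IsWeakSolution.eLpNorm_le_mul_eLpNorm`).

Since p r' σ = p*, the choice s = σ^(n+1) leads from L^(p* σ^n) to L^(p* σ^(n+1)). The iteration
starts in L^(p*), where `v` lies by definition, and σ > 1 makes the product of the constants
converge. Hence ‖v‖_∞ ≤ M₁ ‖v‖_{p*}, which is stronger than the stated bound: K and L_v only enlarge
the right-hand side.

The constant C comes from the Gagliardo–Nirenberg–Sobolev inequality for compactly supported
functions. It is carried over to weak gradients by cutoffs and mollification, so the best constants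
S_m are never needed. Mollification also gives the chain rule for weak gradients, which makes the
test functions admissible. -/

namespace PQLaplace

/-! ### Mollification. -/

open Filter Topology Set Metric ContinuousLinearMap
open scoped Convolution

/-- A sequence of bump functions at the origin shrinking to a point. -/
noncomputable def shrinkingBump (N n : ℕ) : ContDiffBump (0 : Space N) where
  rIn := 1 / (2 * (n + 1))
  rOut := 1 / (n + 1)
  rIn_pos := by positivity
  rIn_lt_rOut := by
    apply one_div_lt_one_div_of_lt <;> linarith [(n.cast_nonneg : (0:ℝ) ≤ n)]

/-- The `n`-th mollification of `f`. -/
noncomputable def mollify {N : ℕ} {F : Type*} [NormedAddCommGroup F] [NormedSpace ℝ F] (n : ℕ)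
    (f : Space N → F) : Space N → F :=
  (shrinkingBump N n).normed volume ⋆[lsmul ℝ ℝ, volume] f

section Mollify

variable {N : ℕ} {F : Type*} [NormedAddCommGroup F] [NormedSpace ℝ F]

theorem shrinkingBump_rOut_le_one (n : ℕ) : (shrinkingBump N n).rOut ≤ 1 := by
  change 1 / ((n : ℝ) + 1) ≤ 1
  rw [div_le_one (by positivity)]
  linarith [(n.cast_nonneg : (0:ℝ) ≤ n)]

theorem mollify_apply (n : ℕ) (f : Space N → F) (x : Space N) :
    mollify n f x = ∫ t, (shrinkingBump N n).normed volume t • f (x - t) := rfl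

theorem mollify_apply_swap (n : ℕ) (f : Space N → F) (x : Space N) :
    mollify n f x = ∫ t, (shrinkingBump N n).normed volume (x - t) • f t := by
  simp only [mollify, convolution_eq_swap, lsmul_apply]

theorem contDiff_mollify [CompleteSpace F] (n : ℕ) {f : Space N → F}
    (hf : LocallyIntegrable f) : ContDiff ℝ ∞ (mollify n f) :=
  (shrinkingBump N n).hasCompactSupport_normed.contDiff_convolution_left _
    (shrinkingBump N n).contDiff_normed hf

theorem ae_tendsto_mollify [CompleteSpace F] {f : Space N → F} (hf : LocallyIntegrable f) :
    ∀ᵐ x, Tendsto (fun n => mollify n f x) atTop (𝓝 (f x)) := by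
  refine ContDiffBump.ae_convolution_tendsto_right_of_locallyIntegrable
    (φ := fun n => shrinkingBump N n) (K := 2) ?_ ?_ hf
  · exact tendsto_one_div_add_atTop_nhds_zero_nat
  · filter_upwards with n
    change 1 / ((n : ℝ) + 1) ≤ 2 * (1 / (2 * (n + 1)))
    apply le_of_eq
    field_simp

theorem mollify_congr_ball (n : ℕ) {f g : Space N → F} {x : Space N}
    (h : ∀ y ∈ closedBall x 1, f y = g y) : mollify n f x = mollify n g x := by
  rw [mollify_apply_swap, mollify_apply_swap]
  refine integral_congr_ae (Eventually.of_forall fun t => ?_)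
  by_cases ht : t ∈ closedBall x 1
  · simp only [h t ht]
  · have : (shrinkingBump N n).normed volume (x - t) = 0 := by
      rw [← Function.notMem_support, ContDiffBump.support_normed_eq]
      intro hmem
      apply ht
      have := (mem_ball_zero_iff.1 hmem).le.trans (shrinkingBump_rOut_le_one n)
      rwa [mem_closedBall, dist_comm, dist_eq_norm]
    simp only [this, zero_smul]

/-- Young's inequality for mollifications. -/
theorem eLpNorm_mollify_le [CompleteSpace F] (n : ℕ) {f : Space N → F}
    (hf : AEStronglyMeasurable f) {p : ℝ} (hp : 1 ≤ p) :
    eLpNorm (mollify n f) (ENNReal.ofReal p) volume ≤ eLpNorm f (ENNReal.ofReal p) volume := by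
  have hp0 : 0 < p := by linarith
  set ρ : Space N → ℝ := (shrinkingBump N n).normed volume with hρ
  have hρc : Continuous ρ := (shrinkingBump N n).continuous_normed
  -- The kernel is turned into a probability measure, so that Jensen's inequality becomes the
  -- comparison of the L^1 and L^p norms for `ν`.
  set ν : Measure (Space N) := volume.withDensity (fun t => ENNReal.ofReal (ρ t)) with hν
  have hρm : Measurable (fun t => ENNReal.ofReal (ρ t)) :=
    ENNReal.measurable_ofReal.comp hρc.measurable
  have hνprob : IsProbabilityMeasure ν := by
    constructor
    rw [hν, withDensity_apply _ MeasurableSet.univ, Measure.restrict_univ,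
      ← ofReal_integral_eq_lintegral_ofReal]
    · rw [hρ, ContDiffBump.integral_normed, ENNReal.ofReal_one]
    · exact (shrinkingBump N n).integrable_normed
    · exact Eventually.of_forall fun x => (shrinkingBump N n).nonneg_normed x
  -- A strongly measurable representative makes (x, t) ↦ g (x - t) jointly measurable, as Tonelli
  -- requires.
  have hcongr : mollify n f = mollify n (hf.mk f) :=
    convolution_congr _ (ae_eq_refl _) hf.ae_eq_mk
  rw [hcongr, eLpNorm_congr_ae hf.ae_eq_mk]
  set g := hf.mk f with hg
  have hgm : StronglyMeasurable g := hf.stronglyMeasurable_mk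
  have hpt : ∀ x, ‖mollify n g x‖ₑ ^ p ≤ ∫⁻ t, ‖g (x - t)‖ₑ ^ p ∂ν := by
    intro x
    have hmeas : StronglyMeasurable (fun t => g (x - t)) :=
      hgm.comp_measurable (measurable_const.sub measurable_id)
    have h1 : ‖mollify n g x‖ₑ ≤ ∫⁻ t, ‖g (x - t)‖ₑ ∂ν := by
      rw [mollify_apply, hν, lintegral_withDensity_eq_lintegral_mul _ hρm hmeas.enorm]
      refine (enorm_integral_le_lintegral_enorm _).trans (lintegral_mono fun t => ?_)
      simp only [Pi.mul_apply, enorm_smul]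
      gcongr
      rw [Real.enorm_eq_ofReal ((shrinkingBump N n).nonneg_normed t)]
    have h2 := eLpNorm_le_eLpNorm_of_exponent_le (μ := ν) (p := 1) (q := ENNReal.ofReal p)
      (by simpa using hp) hmeas.aestronglyMeasurable
    rw [eLpNorm_one_eq_lintegral_enorm, eLpNorm_eq_lintegral_rpow_enorm_toReal
      (by simpa using hp0) ENNReal.ofReal_ne_top, ENNReal.toReal_ofReal hp0.le] at h2
    calc ‖mollify n g x‖ₑ ^ p
        ≤ ((∫⁻ t, ‖g (x - t)‖ₑ ^ p ∂ν) ^ (1 / p)) ^ p := by gcongr; exact h1.trans h2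
      _ = _ := by rw [← ENNReal.rpow_mul, one_div_mul_cancel hp0.ne', ENNReal.rpow_one]
  rw [eLpNorm_eq_lintegral_rpow_enorm_toReal (by simpa using hp0) ENNReal.ofReal_ne_top,
    eLpNorm_eq_lintegral_rpow_enorm_toReal (by simpa using hp0) ENNReal.ofReal_ne_top,
    ENNReal.toReal_ofReal hp0.le]
  gcongr ?_ ^ _
  calc ∫⁻ x, ‖mollify n g x‖ₑ ^ p ≤ ∫⁻ x, ∫⁻ t, ‖g (x - t)‖ₑ ^ p ∂ν := lintegral_mono hpt
    _ = ∫⁻ t, (∫⁻ x, ‖g (x - t)‖ₑ ^ p) ∂ν := by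
        apply lintegral_lintegral_swap
        apply Measurable.aemeasurable
        exact ((hgm.comp_measurable
          (measurable_fst.sub measurable_snd)).enorm.pow_const p)
    _ = ∫⁻ _t, (∫⁻ x, ‖g x‖ₑ ^ p) ∂ν := by
        congr with t
        exact lintegral_sub_right_eq_self (fun x => ‖g x‖ₑ ^ p) t
    _ = ∫⁻ x, ‖g x‖ₑ ^ p := by simp

/-- Scheffé's lemma: almost everywhere convergence without gain of mass is `L¹` convergence. -/
theorem tendsto_integral_norm_sub_of_ae_tendsto {α V : Type*} [MeasurableSpace α] {μ : Measure α}
    [NormedAddCommGroup V] {u : ℕ → α → V} {f : α → V} (hu : ∀ n, Integrable (u n) μ) (hf : Integrable f μ)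
    (hlim : ∀ᵐ x ∂μ, Tendsto (fun n => u n x) atTop (𝓝 (f x)))
    (hle : ∀ n, ∫ x, ‖u n x‖ ∂μ ≤ ∫ x, ‖f x‖ ∂μ) :
    Tendsto (fun n => ∫ x, ‖u n x - f x‖ ∂μ) atTop (𝓝 0) := by
  -- This combination lies between 0 and 2‖f‖, so dominated convergence applies although no majorant
  -- of `u n` is known.
  have hw : Tendsto (fun n => ∫ x, (‖u n x - f x‖ - ‖u n x‖ + ‖f x‖) ∂μ) atTop
      (𝓝 (∫ _x, (0 : ℝ) ∂μ)) := by
    refine tendsto_integral_of_dominated_convergence (fun x => 2 * ‖f x‖) (fun n => ?_)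
      (hf.norm.const_mul 2) (fun n => ?_) ?_
    · exact ((((hu n).sub hf).norm.sub (hu n).norm).add hf.norm).aestronglyMeasurable
    · filter_upwards with x
      rw [Real.norm_eq_abs, abs_le]
      have h1 := norm_sub_le (u n x) (f x)
      have h2 := norm_sub_norm_le (u n x) (f x)
      constructor <;> linarith [norm_nonneg (f x)]
    · filter_upwards [hlim] with x hx
      have h1 : Tendsto (fun n => ‖u n x - f x‖ - ‖u n x‖ + ‖f x‖) atTop
          (𝓝 (‖f x - f x‖ - ‖f x‖ + ‖f x‖)) :=
        ((hx.sub_const _).norm.sub hx.norm).add_const _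
      simpa using h1
  rw [integral_zero] at hw
  refine squeeze_zero (fun n => integral_nonneg fun x => norm_nonneg _) (fun n => ?_) hw
  have hd : Integrable (fun x => ‖u n x - f x‖) μ := ((hu n).sub hf).norm
  have hd' : Integrable (fun x => ‖u n x - f x‖ - ‖u n x‖) μ := hd.sub (hu n).norm
  rw [integral_add hd' hf.norm, integral_sub hd (hu n).norm]
  linarith [hle n]

/-- Mollifications converge in `L¹` on balls. -/
theorem tendsto_integral_norm_mollify_sub [CompleteSpace F] {f : Space N → F}
    (hf : LocallyIntegrable f) (R : ℝ) :
    Tendsto (fun n => ∫ x in closedBall 0 R, ‖mollify n f x - f x‖) atTop (𝓝 0) := by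
  -- The kernels have radius at most 1, so cutting off at R + 1 does not change the mollification on
  -- the ball of radius R.
  set g := (closedBall (0 : Space N) (R + 1)).indicator f with hg
  have hgi : Integrable g :=
    (hf.integrableOn_isCompact (isCompact_closedBall _ _)).integrable_indicator
      isClosed_closedBall.measurableSet
  have hle : ∀ n, eLpNorm (mollify n g) 1 volume ≤ eLpNorm g 1 volume := fun n => by
    simpa using eLpNorm_mollify_le n hgi.aestronglyMeasurable le_rfl
  have hmi : ∀ n, Integrable (mollify n g) := fun n => by
    refine memLp_one_iff_integrable.1
      ⟨(contDiff_mollify n hgi.locallyIntegrable).continuous.aestronglyMeasurable, ?_⟩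
    exact (hle n).trans_lt (memLp_one_iff_integrable.2 hgi).2
  have hmain := tendsto_integral_norm_sub_of_ae_tendsto hmi hgi
    (ae_tendsto_mollify hgi.locallyIntegrable) (fun n => by
      have := hle n
      rw [eLpNorm_one_eq_lintegral_enorm, eLpNorm_one_eq_lintegral_enorm,
        ← ofReal_integral_norm_eq_lintegral_enorm (hmi n),
        ← ofReal_integral_norm_eq_lintegral_enorm hgi] at this
      exact (ENNReal.ofReal_le_ofReal_iff (integral_nonneg fun x => norm_nonneg _)).1 this)
  refine squeeze_zero (fun n => integral_nonneg fun x => norm_nonneg _) (fun n => ?_) hmain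
  calc ∫ x in closedBall 0 R, ‖mollify n f x - f x‖
      = ∫ x in closedBall 0 R, ‖mollify n g x - g x‖ := by
        refine setIntegral_congr_fun isClosed_closedBall.measurableSet fun x hx => ?_
        have hx' : ∀ y ∈ closedBall x 1, f y = g y := fun y hy => by
          rw [hg, indicator_of_mem]
          rw [mem_closedBall] at hx hy ⊢
          linarith [dist_triangle y x 0]
        simp only [mollify_congr_ball n hx', hx' x (mem_closedBall_self zero_le_one)]
    _ ≤ ∫ x, ‖mollify n g x - g x‖ :=
        setIntegral_le_integral ((hmi n).sub hgi).norm
          (Eventually.of_forall fun x => norm_nonneg _)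

/-- The gradient of the mollification is the mollification of the weak gradient. -/
theorem fderiv_mollify (n : ℕ) {u : Space N → ℝ} {g : Space N → Space N}
    (h : HasWeakGrad u g) (x : Space N) :
    fderiv ℝ (mollify n u) x = innerSL ℝ (mollify n g x) := by
  obtain ⟨hu, hg, hw⟩ := h
  set ρ : Space N → ℝ := (shrinkingBump N n).normed volume with hρ
  have hρs : HasCompactSupport ρ := (shrinkingBump N n).hasCompactSupport_normed
  have hρd : ContDiff ℝ ∞ ρ := (shrinkingBump N n).contDiff_normed
  have hd := hρs.hasFDerivAt_convolution_left (lsmul ℝ ℝ) (μ := volume)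
    (hρd.of_le (by simp)) hu x
  have hφ : ContDiff ℝ ∞ (fun t => ρ (x - t)) := hρd.comp (contDiff_const.sub contDiff_id)
  have hφs : HasCompactSupport (fun t => ρ (x - t)) :=
    hρs.comp_homeomorph (Homeomorph.subLeft x)
  have key : ∀ i : Fin N, fderiv ℝ (mollify n u) x (EuclideanSpace.single i 1)
      = mollify n g x i := by
    intro i
    -- The weak gradient is tested with t ↦ ρ (x - t); the sign from the reflection cancels the one
    -- from integration by parts.
    have h1 := hw _ hφ hφs i
    have h2 : ∀ t, fderiv ℝ (fun t => ρ (x - t)) t = - fderiv ℝ ρ (x - t) := fun t => by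
      have := (hρd.differentiable (by simp) (x - t)).hasFDerivAt.comp t
        ((hasFDerivAt_id t).const_sub x)
      rw [show (fun t => ρ (x - t)) = ρ ∘ HSub.hSub x from rfl, this.fderiv]
      ext y
      simp
    have h3 : mollify n g x i = ∫ t, g t i * ρ (x - t) := by
      rw [mollify_apply_swap]
      have hint : Integrable (fun t => ρ (x - t) • g t) :=
        hg.integrable_smul_left_of_hasCompactSupport hφ.continuous hφs
      have := (EuclideanSpace.proj i : Space N →L[ℝ] ℝ).integral_comp_comm hint
      refine this.symm.trans ?_
      refine integral_congr_ae (Eventually.of_forall fun t => ?_)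
      simp [mul_comm]
    rw [h3, show fderiv ℝ (mollify n u) x = _ from hd.fderiv, ← neg_eq_iff_eq_neg.2 h1,
      convolution_eq_swap, ← integral_neg]
    have hint : Integrable (fun t => ((lsmul ℝ ℝ).precompL (Space N)) (fderiv ℝ ρ (x - t)) (u t)) := by
      have := (hρs.fderiv ℝ).convolutionExists_left ((lsmul ℝ ℝ).precompL (Space N))
        (hρd.continuous_fderiv (by simp)) hu x
      exact this.integrable_swap
    refine (ContinuousLinearMap.integral_apply hint _).trans ?_
    refine integral_congr_ae (Eventually.of_forall fun t => ?_)
    simp [h2, precompL_apply, mul_comm]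
  have hb : (fderiv ℝ (mollify n u) x).toLinearMap
      = (innerSL ℝ (mollify n g x)).toLinearMap := by
    refine (EuclideanSpace.basisFun (Fin N) ℝ).toBasis.ext fun i => ?_
    simp [key, EuclideanSpace.inner_single_right]
  ext y
  exact congrArg (fun L => L y) hb

end Mollify

end PQLaplace

/-! ### The chain rule for weak gradients. -/

namespace PQLaplace

open Filter Topology Set Metric ContinuousLinearMap

variable {N : ℕ}

theorem LocallyIntegrable.coord {g : Space N → Space N} (hg : LocallyIntegrable g) (i : Fin N) :
    LocallyIntegrable (fun x => g x i) :=
  hg.mono ((EuclideanSpace.proj i : Space N →L[ℝ] ℝ).continuous.comp_aestronglyMeasurable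
    hg.aestronglyMeasurable) (Eventually.of_forall fun x => PiLp.norm_apply_le (g x) i)

theorem LocallyIntegrable.bounded_mul {f c : Space N → ℝ} (hf : LocallyIntegrable f)
    (hc : AEStronglyMeasurable c) {M : ℝ} (hM : ∀ x, |c x| ≤ M) :
    LocallyIntegrable (fun x => c x * f x) := by
  refine (hf.smul M).mono (hc.mul hf.aestronglyMeasurable) (Eventually.of_forall fun x => ?_)
  have h0 : 0 ≤ M := (abs_nonneg _).trans (hM x)
  simp only [Pi.smul_apply, smul_eq_mul, norm_mul, Real.norm_eq_abs, abs_of_nonneg h0]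
  gcongr
  exact hM x

theorem tendsto_integral_sub_integral_of_ball {R C : ℝ} {F G d : ℕ → Space N → ℝ}
    (hF : ∀ n, Integrable (F n)) (hG : ∀ n, Integrable (G n))
    (hd : ∀ n, IntegrableOn (d n) (closedBall 0 R))
    (hin : ∀ n, ∀ x ∈ closedBall (0 : Space N) R, |F n x - G n x| ≤ C * d n x)
    (hout : ∀ n, ∀ x ∉ closedBall (0 : Space N) R, F n x = G n x)
    (hlim : Tendsto (fun n => ∫ x in closedBall 0 R, d n x) atTop (𝓝 0)) :
    Tendsto (fun n => (∫ x, F n x) - ∫ x, G n x) atTop (𝓝 0) := by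
  refine squeeze_zero_norm (a := fun n => C * ∫ x in closedBall 0 R, d n x) (fun n => ?_)
    (by simpa using hlim.const_mul C)
  rw [← integral_sub (hF n) (hG n), ← setIntegral_eq_integral_of_forall_compl_eq_zero
    (s := closedBall 0 R) (fun x hx => sub_eq_zero.2 (hout n x hx)), ← integral_const_mul]
  refine norm_integral_le_of_norm_le ((hd n).const_mul C) ?_
  exact (ae_restrict_iff' isClosed_closedBall.measurableSet).2
    (Eventually.of_forall fun x hx => hin n x hx)

/-- Chain rule for weak gradients: composition with a `C¹` function with bounded derivative. -/
theorem HasWeakGrad.comp {u : Space N → ℝ} {g : Space N → Space N} (h : HasWeakGrad u g)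
    {f : ℝ → ℝ} (hf : ContDiff ℝ 1 f) {M : ℝ} (hM : ∀ t, |deriv f t| ≤ M) :
    HasWeakGrad (fun x => f (u x)) (fun x => deriv f (u x) • g x) := by
  have hM0 : 0 ≤ M := (abs_nonneg _).trans (hM 0)
  have hf' : Continuous (deriv f) := hf.continuous_deriv le_rfl
  have hfd : Differentiable ℝ f := hf.differentiable one_ne_zero
  have hlip : ∀ s t, |f s - f t| ≤ M * |s - t| := fun s t =>
    convex_univ.norm_image_sub_le_of_norm_deriv_le (fun x _ => hfd x) (fun x _ => hM x)
      (mem_univ t) (mem_univ s)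
  have hum := h.1.aestronglyMeasurable
  have hgm := h.2.1.aestronglyMeasurable
  have hfu : LocallyIntegrable (fun x => f (u x)) := by
    have hun : LocallyIntegrable (fun x => |u x|) :=
      h.1.mono hum.norm (Eventually.of_forall fun x => by simp)
    refine ((locallyIntegrable_const |f 0|).add (hun.smul M)).mono
      (hf.continuous.comp_aestronglyMeasurable hum) (Eventually.of_forall fun x => ?_)
    simp only [Pi.add_apply, Pi.smul_apply, smul_eq_mul, Real.norm_eq_abs]
    rw [abs_of_nonneg (by positivity : 0 ≤ |f 0| + M * |u x|)]
    have := hlip (u x) 0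
    rw [sub_zero] at this
    linarith [abs_sub_abs_le_abs_sub (f (u x)) (f 0)]
  have hfg : LocallyIntegrable (fun x => deriv f (u x) • g x) := by
    refine (h.2.1.smul M).mono ((hf'.comp_aestronglyMeasurable hum).smul hgm)
      (Eventually.of_forall fun x => ?_)
    simp only [Pi.smul_apply, norm_smul, Real.norm_eq_abs, abs_of_nonneg hM0]
    gcongr
    exact hM _
  refine ⟨hfu, hfg, fun φ hφ hφs i => ?_⟩
  set e : Space N := EuclideanSpace.single i 1 with he
  have hψc : Continuous (fun x => fderiv ℝ φ x e) :=
    (hφ.continuous_fderiv (by simp)).clm_apply continuous_const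
  have hψs : HasCompactSupport (fun x => fderiv ℝ φ x e) := hφs.fderiv_apply ℝ e
  obtain ⟨R, hR⟩ := hφs.isCompact.isBounded.subset_closedBall (0 : Space N)
  have hφ0 : ∀ x ∉ closedBall (0 : Space N) R, φ x = 0 := fun x hx =>
    image_eq_zero_of_notMem_tsupport fun hx' => hx (hR hx')
  have hψ0 : ∀ x ∉ closedBall (0 : Space N) R, fderiv ℝ φ x e = 0 := fun x hx => by
    rw [fderiv_of_notMem_tsupport ℝ fun hx' => hx (hR hx')]
    rfl
  obtain ⟨B, hB⟩ := hφs.exists_bound_of_continuous hφ.continuous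
  obtain ⟨B', hB'⟩ := hψs.exists_bound_of_continuous hψc
  have hB0 : 0 ≤ B := (norm_nonneg _).trans (hB 0)
  have hB0' : 0 ≤ B' := (norm_nonneg _).trans (hB' 0)
  set w : ℕ → Space N → ℝ := fun n => mollify n u with hw
  set G : ℕ → Space N → Space N := fun n => mollify n g with hG
  have hwd : ∀ n, ContDiff ℝ ∞ (w n) := fun n => contDiff_mollify n h.1
  have hGd : ∀ n, ContDiff ℝ ∞ (G n) := fun n => contDiff_mollify n h.2.1
  have hGc : ∀ n, Continuous (fun x => G n x i) := fun n =>
    (EuclideanSpace.proj i : Space N →L[ℝ] ℝ).continuous.comp (hGd n).continuous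
  have hgi := LocallyIntegrable.coord h.2.1 i
  have hfw : ∀ n, Continuous (fun x => f (w n x)) := fun n =>
    hf.continuous.comp (hwd n).continuous
  have hfw' : ∀ n, Continuous (fun x => deriv f (w n x)) := fun n =>
    hf'.comp (hwd n).continuous
  have hI1 : ∀ n, Integrable (fun x => f (w n x) * fderiv ℝ φ x e) := fun n =>
    ((hfw n).mul hψc).integrable_of_hasCompactSupport hψs.mul_left
  have hI2 : ∀ n, Integrable (fun x => deriv f (w n x) * G n x i * φ x) := fun n =>
    (((hfw' n).mul (hGc n)).mul hφ.continuous).integrable_of_hasCompactSupport hφs.mul_left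
  have hI3 : ∀ n, Integrable (fun x => deriv f (w n x) * g x i * φ x) := fun n =>
    (LocallyIntegrable.bounded_mul hgi (hfw' n).aestronglyMeasurable
      fun x => hM _).integrable_smul_right_of_hasCompactSupport hφ.continuous hφs
  have hderiv : ∀ n x, fderiv ℝ (fun x => f (w n x)) x e = deriv f (w n x) * G n x i := by
    intro n x
    have h1 : HasFDerivAt (fun x => f (w n x)) (deriv f (w n x) • fderiv ℝ (w n) x) x :=
      (hfd (w n x)).hasDerivAt.comp_hasFDerivAt x
        ((hwd n).differentiable (by simp) x).hasFDerivAt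
    rw [h1.fderiv, hw]
    simp only [fderiv_mollify n h, smul_apply, smul_eq_mul, innerSL_apply_apply, he,
      EuclideanSpace.inner_single_right, hG]
    simp
  -- For the smooth mollifications this is classical integration by parts; what remains is the limit
  -- in n.
  have hparts : ∀ n, ∫ x, f (w n x) * fderiv ℝ φ x e
      = - ∫ x, deriv f (w n x) * G n x i * φ x := by
    intro n
    have := integral_mul_fderiv_eq_neg_fderiv_mul_of_integrable (μ := volume)
      (f := fun x => f (w n x)) (g := φ) (v := e) (by simpa only [hderiv] using hI2 n) (hI1 n)
      (((hfw n).mul hφ.continuous).integrable_of_hasCompactSupport hφs.mul_left)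
      (fun x _ => (hfd _).comp x ((hwd n).differentiable (by simp) x))
      (fun x _ => hφ.differentiable (by simp) x)
    simpa only [hderiv] using this
  have hT1 : Tendsto (fun n => ∫ x, f (w n x) * fderiv ℝ φ x e) atTop
      (𝓝 (∫ x, f (u x) * fderiv ℝ φ x e)) := by
    rw [← tendsto_sub_nhds_zero_iff]
    refine tendsto_integral_sub_integral_of_ball (R := R) (C := M * B')
      (G := fun _ x => f (u x) * fderiv ℝ φ x e) (d := fun n x => ‖w n x - u x‖) hI1
      (fun _ => hfu.integrable_smul_right_of_hasCompactSupport hψc hψs)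
      (fun n => ?_) (fun n x _ => ?_) (fun n x hx => by simp [hψ0 x hx])
      (tendsto_integral_norm_mollify_sub h.1 R)
    · exact ((((hwd n).continuous.locallyIntegrable).integrableOn_isCompact
        (isCompact_closedBall _ _)).sub
        (h.1.integrableOn_isCompact (isCompact_closedBall _ _))).norm
    · rw [← sub_mul, abs_mul, mul_right_comm]
      exact mul_le_mul (hlip _ _) (hB' x) (abs_nonneg _) (by positivity)
  -- Two stages are needed because f' is merely bounded and continuous: first `G n` is replaced by
  -- `g` using local L^1 convergence, then f'(w n) by f'(u) using dominated convergence.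
  have hT2 : Tendsto (fun n => (∫ x, deriv f (w n x) * G n x i * φ x)
      - ∫ x, deriv f (w n x) * g x i * φ x) atTop (𝓝 0) := by
    refine tendsto_integral_sub_integral_of_ball (R := R) (C := M * B)
      (d := fun n x => ‖G n x - g x‖) hI2 hI3
      (fun n => ?_) (fun n x _ => ?_) (fun n x hx => by simp [hφ0 x hx])
      (tendsto_integral_norm_mollify_sub h.2.1 R)
    · exact ((((hGd n).continuous.locallyIntegrable).integrableOn_isCompact
        (isCompact_closedBall _ _)).sub
        (h.2.1.integrableOn_isCompact (isCompact_closedBall _ _))).norm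
    · rw [← sub_mul, ← mul_sub, abs_mul, abs_mul, mul_right_comm M]
      exact mul_le_mul (mul_le_mul (hM _) (PiLp.norm_apply_le (G n x - g x) i) (abs_nonneg _) hM0)
        (hB x) (abs_nonneg _) (by positivity)
  have hT3 : Tendsto (fun n => ∫ x, deriv f (w n x) * g x i * φ x) atTop
      (𝓝 (∫ x, deriv f (u x) * g x i * φ x)) := by
    refine tendsto_integral_of_dominated_convergence (fun x => M * ‖g x i * φ x‖)
      (fun n => (hI3 n).aestronglyMeasurable)
      ((hgi.integrable_smul_right_of_hasCompactSupport hφ.continuous hφs).norm.const_mul M)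
      (fun n => Eventually.of_forall fun x => ?_) ?_
    · rw [mul_assoc, norm_mul]
      gcongr
      exact hM _
    · filter_upwards [ae_tendsto_mollify h.1] with x hx
      exact (((hf'.tendsto _).comp hx).mul_const _).mul_const _
  have hT4 : Tendsto (fun n => ∫ x, f (w n x) * fderiv ℝ φ x e) atTop
      (𝓝 (- ∫ x, deriv f (u x) * g x i * φ x)) := by
    simp only [hparts]
    simpa using (hT2.add hT3).neg
  simpa using tendsto_nhds_unique hT1 hT4

end PQLaplace

/-! ### The Sobolev inequality without compact support. -/

namespace PQLaplace

open Filter Topology Set Metric ContinuousLinearMap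
open scoped NNReal

variable {N : ℕ}

theorem critExp_pos {p : ℝ} (hp : 0 < p) (hpN : p < N) : 0 < critExp N p := by
  have : 0 < (N : ℝ) - p := by linarith
  have : (0 : ℝ) < N := by linarith
  unfold critExp
  positivity

theorem inv_critExp {p : ℝ} (hp : 0 < p) (hpN : p < N) :
    (critExp N p)⁻¹ = p⁻¹ - (N : ℝ)⁻¹ := by
  have : (N : ℝ) ≠ 0 := by linarith
  unfold critExp
  field_simp

/-- A smooth cutoff equal to `1` on the unit ball and vanishing outside the ball of radius `2`. -/
noncomputable def unitCutoff (N : ℕ) : ContDiffBump (0 : Space N) where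
  rIn := 1
  rOut := 2
  rIn_pos := one_pos
  rIn_lt_rOut := one_lt_two

/-- Dilated cutoffs, equal to `1` on the ball of radius `n + 1`. -/
noncomputable def cutoff (N n : ℕ) (x : Space N) : ℝ := unitCutoff N ((n + 1 : ℝ)⁻¹ • x)

theorem contDiff_cutoff (n : ℕ) : ContDiff ℝ ∞ (cutoff N n) :=
  (unitCutoff N).contDiff.comp (contDiff_const_smul _)

theorem abs_cutoff_le_one (n : ℕ) (x : Space N) : |cutoff N n x| ≤ 1 := by
  change |unitCutoff N _| ≤ 1
  rw [abs_of_nonneg (unitCutoff N).nonneg]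
  exact (unitCutoff N).le_one

theorem hasCompactSupport_cutoff (n : ℕ) : HasCompactSupport (cutoff N n) :=
  (unitCutoff N).hasCompactSupport.comp_smul (by positivity)

theorem cutoff_eq_one {n : ℕ} {x : Space N} (hx : ‖x‖ ≤ n + 1) : cutoff N n x = 1 := by
  apply (unitCutoff N).one_of_mem_closedBall
  rw [mem_closedBall_zero_iff, norm_smul, norm_inv, Real.norm_of_nonneg (by positivity)]
  change (n + 1 : ℝ)⁻¹ * ‖x‖ ≤ 1
  rw [inv_mul_le_iff₀ (by positivity)]
  simpa using hx

theorem fderiv_cutoff_eq_zero {n : ℕ} {x : Space N} (hx : ‖x‖ < n + 1) :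
    fderiv ℝ (cutoff N n) x = 0 := by
  have : cutoff N n =ᶠ[𝓝 x] fun _ => 1 := by
    filter_upwards [continuous_norm.continuousAt.eventually_lt continuousAt_const hx] with y hy
    exact cutoff_eq_one hy.le
  rw [this.fderiv_eq]
  simp

theorem fderiv_cutoff_eq_zero_of_lt {n : ℕ} {x : Space N} (hx : 2 * (n + 1 : ℝ) < ‖x‖) :
    fderiv ℝ (cutoff N n) x = 0 := by
  have : cutoff N n =ᶠ[𝓝 x] fun _ => 0 := by
    filter_upwards [continuousAt_const.eventually_lt continuous_norm.continuousAt hx] with y hy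
    apply (unitCutoff N).zero_of_le_dist
    rw [dist_zero_right, norm_smul, norm_inv, Real.norm_of_nonneg (by positivity)]
    change 2 ≤ (n + 1 : ℝ)⁻¹ * ‖y‖
    rw [le_inv_mul_iff₀ (by positivity)]
    linarith
  rw [this.fderiv_eq]
  simp

/-- The `L^N` norms of the gradients of the dilated cutoffs are bounded. -/
theorem exists_eLpNorm_fderiv_cutoff_le (hN : 0 < N) :
    ∃ C : ℝ≥0, ∀ n, eLpNorm (fderiv ℝ (cutoff N n)) N volume ≤ C := by
  obtain ⟨B, hB⟩ := ((unitCutoff N).hasCompactSupport.fderiv ℝ).exists_bound_of_continuous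
    ((unitCutoff N).contDiff.continuous_fderiv (n := ∞) (by simp))
  have hB0 : 0 ≤ B := (norm_nonneg _).trans (hB 0)
  have hN' : (N : ℝ≥0∞) ≠ 0 := by exact_mod_cast hN.ne'
  -- Scaling makes the exponent N critical: the gradient is at most B / (n + 1) on a ball whose
  -- volume to the power 1/N is 2 (n + 1) V, so n cancels.
  set V := (volume (closedBall (0 : Space N) 1)).toReal ^ (1 / (N : ℝ)) with hV
  have hVol : volume (closedBall (0 : Space N) 1) ≠ ⊤ := measure_closedBall_lt_top.ne
  refine ⟨(B * 2 * V).toNNReal, fun n => ?_⟩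
  have hn : (0 : ℝ) < n + 1 := by positivity
  have hder : ∀ x, ‖fderiv ℝ (cutoff N n) x‖ ≤ B * (n + 1 : ℝ)⁻¹ := fun x => by
    have h1 := ((unitCutoff N).contDiff.differentiable (n := ∞) (by simp)
      ((n + 1 : ℝ)⁻¹ • x)).hasFDerivAt.comp x ((hasFDerivAt_id x).const_smul (n + 1 : ℝ)⁻¹)
    have h2 : fderiv ℝ (cutoff N n) x = _ := h1.fderiv
    rw [h2, comp_smul, norm_smul, norm_inv, Real.norm_of_nonneg hn.le, mul_comm,
      ContinuousLinearMap.comp_id]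
    gcongr
    exact hB _
  have hle : ∀ x, ‖fderiv ℝ (cutoff N n) x‖
      ≤ ‖(closedBall (0 : Space N) (2 * (n + 1))).indicator (fun _ => B * (n + 1 : ℝ)⁻¹) x‖ := by
    intro x
    by_cases hx : x ∈ closedBall (0 : Space N) (2 * (n + 1))
    · rw [indicator_of_mem hx]
      exact (hder x).trans (le_abs_self _)
    · rw [fderiv_cutoff_eq_zero_of_lt (by simpa using hx)]
      simp
  refine (eLpNorm_mono hle).trans ?_
  rw [eLpNorm_indicator_const isClosed_closedBall.measurableSet hN' (by simp),
    Measure.addHaar_closedBall' _ _ (by positivity), finrank_euclideanSpace_fin,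
    ENNReal.toReal_natCast, ENNReal.mul_rpow_of_nonneg _ _ (by positivity),
    ENNReal.ofReal_rpow_of_nonneg (by positivity) (by positivity), ← Real.rpow_natCast,
    ← Real.rpow_mul (by positivity), mul_one_div_cancel (by exact_mod_cast hN.ne'), Real.rpow_one,
    Real.enorm_eq_ofReal (by positivity), ← ENNReal.ofReal_toReal hVol,
    ENNReal.ofReal_rpow_of_nonneg (by positivity) (by positivity), ← hV,
    ← ENNReal.ofReal_mul (by positivity), ← ENNReal.ofReal_mul (by positivity)]
  apply le_of_eq
  change _ = ENNReal.ofReal _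
  congr 1
  field_simp

/-- The tails of a function in `L^s` vanish at infinity. -/
theorem tendsto_eLpNorm_indicator_compl_ball {w : Space N → ℝ} {s : ℝ} (hs : 0 < s)
    (hw : MemLp w (ENNReal.ofReal s)) :
    Tendsto (fun n : ℕ => eLpNorm ((ball (0 : Space N) (n + 1))ᶜ.indicator w) (ENNReal.ofReal s)
      volume) atTop (𝓝 0) := by
  have hs0 : ENNReal.ofReal s ≠ 0 := by simpa using hs
  have hfin := lintegral_rpow_enorm_lt_top_of_eLpNorm_lt_top hs0 ENNReal.ofReal_ne_top hw.2
  rw [ENNReal.toReal_ofReal hs.le] at hfin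
  have hlim : Tendsto (fun n : ℕ => ∫⁻ x, ‖(ball (0 : Space N) (n + 1))ᶜ.indicator w x‖ₑ ^ s) atTop
      (𝓝 (∫⁻ _x : Space N, 0)) := by
    refine tendsto_lintegral_of_dominated_convergence' (fun x => ‖w x‖ₑ ^ s) (fun n => ?_)
      (fun n => ?_) hfin.ne ?_
    · exact (hw.1.indicator measurableSet_ball.compl).enorm.pow_const s
    · filter_upwards with x
      gcongr
      exact enorm_indicator_le_enorm_self _ _
    · filter_upwards with x
      apply tendsto_const_nhds.congr'
      obtain ⟨m, hm⟩ := exists_nat_gt ‖x‖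
      filter_upwards [eventually_ge_atTop m] with n hn
      rw [indicator_of_notMem]
      · simp [ENNReal.zero_rpow_of_pos hs]
      · have : (m : ℝ) ≤ n := by exact_mod_cast hn
        simp only [mem_compl_iff, mem_ball_zero_iff, not_not]
        linarith
  have hpow := ((ENNReal.continuous_rpow_const (y := 1 / s)).tendsto _).comp hlim
  rw [lintegral_zero, ENNReal.zero_rpow_of_pos (by positivity)] at hpow
  refine hpow.congr fun n => ?_
  rw [eLpNorm_eq_lintegral_rpow_enorm_toReal hs0 ENNReal.ofReal_ne_top,
    ENNReal.toReal_ofReal hs.le, Function.comp_apply]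

/-- Sobolev inequality for smooth functions in `L^{p*}`, not necessarily compactly supported. -/
theorem exists_eLpNorm_le_eLpNorm_fderiv {p : ℝ} (hp : 1 ≤ p) (hpN : p < N) :
    ∃ C : ℝ≥0, ∀ w : Space N → ℝ, ContDiff ℝ ∞ w →
      MemLp w (ENNReal.ofReal (critExp N p)) →
      eLpNorm w (ENNReal.ofReal (critExp N p)) volume
        ≤ C * eLpNorm (fderiv ℝ w) (ENNReal.ofReal p) volume := by
  have hp0 : 0 < p := by linarith
  have hN0 : (0 : ℝ) < N := by linarith
  have hs := critExp_pos hp0 hpN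
  refine ⟨SNormLESNormFDerivOfEqConst ℝ (volume : Measure (Space N)) p.toNNReal,
    fun w hw hwL => ?_⟩
  set C := SNormLESNormFDerivOfEqConst ℝ (volume : Measure (Space N)) p.toNNReal with hC
  obtain ⟨B, hB⟩ := exists_eLpNorm_fderiv_cutoff_le (N := N) (by exact_mod_cast hN0)
  have hwd : Differentiable ℝ w := hw.differentiable (by simp)
  have hχd : ∀ n, Differentiable ℝ (cutoff N n) := fun n =>
    (contDiff_cutoff n).differentiable (by simp)
  have htail := tendsto_eLpNorm_indicator_compl_ball hs hwL
  set t : ℕ → ℝ≥0∞ := fun n => eLpNorm ((ball (0 : Space N) (n + 1))ᶜ.indicator w)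
    (ENNReal.ofReal (critExp N p)) volume with ht
  -- The relation 1/p = 1/p* + 1/N pairs `w` in L^(p*) with the cutoff's gradient in L^N.
  have : ENNReal.HolderTriple (ENNReal.ofReal (critExp N p)) N (ENNReal.ofReal p) := by
    constructor
    rw [← ENNReal.ofReal_inv_of_pos hs, ← ENNReal.ofReal_inv_of_pos hp0,
      ← ENNReal.ofReal_natCast, ← ENNReal.ofReal_inv_of_pos hN0, inv_critExp hp0 hpN,
      ← ENNReal.ofReal_add _ (by positivity)]
    · ring_nf
    · rw [sub_nonneg]
      gcongr
  have hfw : Continuous (fderiv ℝ w) := hw.continuous_fderiv (by simp)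
  have hfχ : ∀ n, Continuous (fderiv ℝ (cutoff N n)) := fun n =>
    (contDiff_cutoff n).continuous_fderiv (by simp)
  have hstep : ∀ n, eLpNorm (fun x => cutoff N n x * w x) (ENNReal.ofReal (critExp N p)) volume
      ≤ C * (eLpNorm (fderiv ℝ w) (ENNReal.ofReal p) volume + t n * B) := by
    intro n
    have hind : AEStronglyMeasurable ((ball (0 : Space N) (n + 1))ᶜ.indicator w) volume :=
      hwL.1.indicator measurableSet_ball.compl
    have hgns := eLpNorm_le_eLpNorm_fderiv_of_eq (volume : Measure (Space N))
      (u := fun x => cutoff N n x * w x) (p := p.toNNReal) (p' := (critExp N p).toNNReal)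
      (((contDiff_cutoff n).mul hw).of_le (by simp)) (hasCompactSupport_cutoff n).mul_right
      (by simpa using hp) (by rw [finrank_euclideanSpace_fin]; exact_mod_cast hN0)
      (by rw [finrank_euclideanSpace_fin, NNReal.coe_inv, Real.coe_toNNReal _ hs.le, Real.coe_toNNReal _ hp0.le,
            inv_critExp hp0 hpN])
    refine hgns.trans ?_
    gcongr
    -- The cutoff is constant on the ball of radius n + 1, so its gradient meets only the tail of
    -- `w`; the error is a vanishing L^(p*) tail times a bounded L^N norm.
    have hfd : fderiv ℝ (fun x => cutoff N n x * w x)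
        = (fun x => cutoff N n x • fderiv ℝ w x)
          + (ball (0 : Space N) (n + 1))ᶜ.indicator w • fderiv ℝ (cutoff N n) := by
      funext x
      rw [show (fun x => cutoff N n x * w x) = cutoff N n * w from rfl,
        fderiv_mul (hχd n x) (hwd x)]
      simp only [Pi.add_apply, Pi.smul_apply']
      congr 1
      by_cases hx : x ∈ ball (0 : Space N) (n + 1)
      · rw [fderiv_cutoff_eq_zero (by simpa using hx)]
        simp
      · rw [indicator_of_mem (by simpa using hx)]
    have hm1 : AEStronglyMeasurable (fun x => cutoff N n x • fderiv ℝ w x) volume :=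
      ((contDiff_cutoff n).continuous.smul hfw).aestronglyMeasurable
    have hm2 : AEStronglyMeasurable
        ((ball (0 : Space N) (n + 1))ᶜ.indicator w • fderiv ℝ (cutoff N n)) volume :=
      hind.smul (hfχ n).aestronglyMeasurable
    have hp1 : (1 : ℝ≥0∞) ≤ ENNReal.ofReal p := by simpa using hp
    rw [hfd]
    refine (eLpNorm_add_le hm1 hm2 hp1).trans ?_
    gcongr ?_ + ?_
    · refine eLpNorm_mono fun x => ?_
      rw [norm_smul]
      exact mul_le_of_le_one_left (norm_nonneg _) (abs_cutoff_le_one n x)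
    · refine (eLpNorm_smul_le_mul_eLpNorm (p := ENNReal.ofReal (critExp N p)) (q := N)
        (hfχ n).aestronglyMeasurable hind).trans ?_
      gcongr
      exact hB n
  have hfatou := Lp.eLpNorm_lim_le_liminf_eLpNorm (p := ENNReal.ofReal (critExp N p))
    (μ := volume) (f := fun n x => cutoff N n x * w x)
    (fun n => ((contDiff_cutoff n).continuous.mul hw.continuous).aestronglyMeasurable) w
    (Eventually.of_forall fun x => by
      apply tendsto_const_nhds.congr'
      obtain ⟨m, hm⟩ := exists_nat_gt ‖x‖
      filter_upwards [eventually_ge_atTop m] with n hn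
      have : (m : ℝ) ≤ n := by exact_mod_cast hn
      rw [cutoff_eq_one (by linarith), one_mul])
  have hlim : Tendsto (fun n => C * (eLpNorm (fderiv ℝ w) (ENNReal.ofReal p) volume + t n * B))
      atTop (𝓝 (C * (eLpNorm (fderiv ℝ w) (ENNReal.ofReal p) volume + 0 * B))) := by
    refine ENNReal.Tendsto.const_mul (tendsto_const_nhds.add ?_) (Or.inr ENNReal.coe_ne_top)
    exact ENNReal.Tendsto.mul_const htail (Or.inr ENNReal.coe_ne_top)
  rw [zero_mul, add_zero] at hlim
  rw [← hlim.liminf_eq]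
  exact hfatou.trans (liminf_le_liminf (Eventually.of_forall hstep))

/-- Sobolev inequality for functions in `L^{p*}` with weak gradient in `L^p`. -/
theorem exists_eLpNorm_le_eLpNorm_weakGrad {p : ℝ} (hp : 1 ≤ p) (hpN : p < N) :
    ∃ C : ℝ≥0, ∀ (u : Space N → ℝ) (g : Space N → Space N), HasWeakGrad u g →
      MemLp u (ENNReal.ofReal (critExp N p)) →
      eLpNorm u (ENNReal.ofReal (critExp N p)) volume
        ≤ C * eLpNorm g (ENNReal.ofReal p) volume := by
  have hp0 : 0 < p := by linarith
  have hs1 : 1 ≤ critExp N p := by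
    unfold critExp
    rw [le_div_iff₀ (by linarith)]
    nlinarith
  obtain ⟨C, hC⟩ := exists_eLpNorm_le_eLpNorm_fderiv hp hpN
  refine ⟨C, fun u g h hu => ?_⟩
  -- Young's inequality is used twice: to keep the mollification in L^(p*) and to bound its gradient
  -- uniformly in n. Fatou then finishes.
  have hbound : ∀ n, eLpNorm (mollify n u) (ENNReal.ofReal (critExp N p)) volume
      ≤ C * eLpNorm g (ENNReal.ofReal p) volume := fun n => by
    have hm : MemLp (mollify n u) (ENNReal.ofReal (critExp N p)) :=
      ⟨(contDiff_mollify n h.1).continuous.aestronglyMeasurable,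
        (eLpNorm_mollify_le n hu.1 hs1).trans_lt hu.2⟩
    refine (hC _ (contDiff_mollify n h.1) hm).trans ?_
    gcongr
    rw [show fderiv ℝ (mollify n u) = fun x => innerSL ℝ (mollify n g x) from
      funext fun x => fderiv_mollify n h x]
    refine le_trans (le_of_eq ?_) (eLpNorm_mollify_le n h.2.1.aestronglyMeasurable hp)
    exact eLpNorm_congr_norm_ae (Eventually.of_forall fun x => innerSL_apply_norm ℝ _)
  refine (Lp.eLpNorm_lim_le_liminf_eLpNorm (f := fun n => mollify n u)
    (fun n => (contDiff_mollify n h.1).continuous.aestronglyMeasurable) u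
    (ae_tendsto_mollify h.1)).trans ?_
  exact (liminf_le_liminf (Eventually.of_forall hbound)).trans (by simp)

end PQLaplace

/-! ### Truncated powers as test functions, and the energy estimate. -/

namespace PQLaplace

open Filter Topology Set
open scoped NNReal

variable {N : ℕ}

/-- The odd primitive of the truncated power `min(|t|, k)^α`. -/
noncomputable def truncPrim (k α t : ℝ) : ℝ := ∫ τ in (0 : ℝ)..t, (min |τ| k) ^ α

section TruncPrim

variable {k α : ℝ}

theorem continuous_truncPow (hα : 0 ≤ α) : Continuous fun t : ℝ => (min |t| k) ^ α :=
  (continuous_abs.min continuous_const).rpow_const fun _ => Or.inr hα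

theorem truncPow_nonneg (hk : 0 ≤ k) (t : ℝ) : 0 ≤ (min |t| k) ^ α :=
  Real.rpow_nonneg (le_min (abs_nonneg t) hk) α

theorem truncPow_le (hk : 0 ≤ k) (hα : 0 ≤ α) (t : ℝ) : (min |t| k) ^ α ≤ k ^ α :=
  Real.rpow_le_rpow (le_min (abs_nonneg t) hk) (min_le_right _ _) hα

theorem hasDerivAt_truncPrim (hα : 0 ≤ α) (t : ℝ) :
    HasDerivAt (truncPrim k α) ((min |t| k) ^ α) t :=
  ((continuous_truncPow hα).integral_hasStrictDerivAt 0 t).hasDerivAt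

theorem deriv_truncPrim (hα : 0 ≤ α) : deriv (truncPrim k α) = fun t => (min |t| k) ^ α :=
  funext fun t => (hasDerivAt_truncPrim hα t).deriv

theorem contDiff_truncPrim (hα : 0 ≤ α) : ContDiff ℝ 1 (truncPrim k α) := by
  rw [contDiff_one_iff_deriv]
  refine ⟨fun t => (hasDerivAt_truncPrim hα t).differentiableAt, ?_⟩
  rw [deriv_truncPrim hα]
  exact continuous_truncPow hα

/-- This linear growth bound depends on k and serves only to make the test function admissible. -/
theorem abs_truncPrim_le (hk : 0 ≤ k) (hα : 0 ≤ α) (t : ℝ) : |truncPrim k α t| ≤ k ^ α * |t| := by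
  have := intervalIntegral.norm_integral_le_of_norm_le_const (a := 0) (b := t)
    (f := fun τ : ℝ => (min |τ| k) ^ α) (C := k ^ α) fun τ _ => by
      rw [Real.norm_of_nonneg (truncPow_nonneg hk τ)]
      exact truncPow_le hk hα τ
  simpa [truncPrim] using this

/-- Uniformity in k is the point: it controls the right-hand side of the tested equation as the
truncation is removed. -/
theorem abs_truncPrim_le_rpow (hk : 0 ≤ k) (hα : 0 ≤ α) (t : ℝ) :
    |truncPrim k α t| ≤ |t| ^ α * |t| := by
  have := intervalIntegral.norm_integral_le_of_norm_le_const (a := 0) (b := t)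
    (f := fun τ : ℝ => (min |τ| k) ^ α) (C := |t| ^ α) fun τ hτ => by
      rw [Real.norm_of_nonneg (truncPow_nonneg hk τ)]
      refine Real.rpow_le_rpow (le_min (abs_nonneg τ) hk) ((min_le_left _ _).trans ?_) hα
      rcases mem_uIoc.1 hτ with h | h
      · rw [abs_of_pos h.1]
        exact h.2.trans (le_abs_self t)
      · rw [abs_of_nonpos h.2, abs_of_neg (h.1.trans_le h.2)]
        linarith [h.1]
  simpa [truncPrim] using this

theorem truncPrim_neg (t : ℝ) : truncPrim k α (-t) = - truncPrim k α t := by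
  have := intervalIntegral.integral_comp_neg (a := 0) (b := t) fun τ : ℝ => (min |τ| k) ^ α
  simp only [abs_neg, neg_zero] at this
  unfold truncPrim
  rw [intervalIntegral.integral_symm, ← this]

/-- This sign lets the A and B terms be discarded. -/
theorem mul_truncPrim_nonneg (hk : 0 ≤ k) (t : ℝ) : 0 ≤ t * truncPrim k α t := by
  have key : ∀ s : ℝ, 0 ≤ s → 0 ≤ truncPrim k α s := fun s hs =>
    intervalIntegral.integral_nonneg hs fun τ _ => truncPow_nonneg hk τ
  rcases le_total 0 t with h | h
  · exact mul_nonneg h (key t h)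
  · have := mul_nonneg (neg_nonneg.2 h) (key (-t) (neg_nonneg.2 h))
    rwa [truncPrim_neg, neg_mul_neg] at this

/-- Below the truncation level the integrand is a pure power; this identifies the pointwise limit as
k → ∞. -/
theorem abs_truncPrim_of_le (hα : 0 ≤ α) {t : ℝ} (ht : |t| ≤ k) :
    |truncPrim k α t| = |t| ^ (α + 1) / (α + 1) := by
  have key : ∀ s : ℝ, 0 ≤ s → s ≤ k → |truncPrim k α s| = s ^ (α + 1) / (α + 1) := by
    intro s hs hsk
    have : truncPrim k α s = s ^ (α + 1) / (α + 1) := by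
      unfold truncPrim
      rw [intervalIntegral.integral_congr (g := fun τ => τ ^ α)]
      · rw [integral_rpow (Or.inl (by linarith)), Real.zero_rpow (by linarith), sub_zero]
      · intro τ hτ
        rw [uIcc_of_le hs] at hτ
        simp only [abs_of_nonneg hτ.1, min_eq_left (hτ.2.trans hsk)]
    rw [this, abs_of_nonneg]
    have := Real.rpow_nonneg hs (α + 1)
    positivity
  rcases le_total 0 t with h | h
  · rw [key t h ((le_abs_self t).trans ht), abs_of_nonneg h]
  · have := key (-t) (neg_nonneg.2 h) ((neg_le_abs t).trans ht)
    rwa [truncPrim_neg, abs_neg, ← abs_of_nonpos h] at this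

end TruncPrim

/-- Composition with a `C¹` function with bounded derivative vanishing at `0` preserves
`D^{1,m}`. -/
theorem MemD.comp {m : ℝ} {u : Space N → ℝ} (hu : MemD m u) {f : ℝ → ℝ} (hf : ContDiff ℝ 1 f)
    {M : ℝ} (hM : ∀ t, |deriv f t| ≤ M) (hfM : ∀ t, |f t| ≤ M * |t|) :
    MemD m (fun x => f (u x)) := by
  obtain ⟨hu, g, hg, hgm⟩ := hu
  refine ⟨hu.of_le_mul (hf.continuous.comp_aestronglyMeasurable hu.1)
    (Eventually.of_forall fun x => hfM _), _, hg.comp hf hM, ?_⟩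
  refine hgm.of_le_mul (c := M) (((hf.continuous_deriv le_rfl).comp_aestronglyMeasurable
    hu.1).smul hgm.1) (Eventually.of_forall fun x => ?_)
  rw [norm_smul]
  gcongr
  exact hM _

theorem integrable_mul_rpow_comp {m M : ℝ} (hm : 0 ≤ m) {u a : Space N → ℝ}
    (ha : Continuous a) (hum : AEStronglyMeasurable u)
    (hi : Integrable (fun x => a x * |u x| ^ m)) {f : ℝ → ℝ} (hf : Continuous f)
    (hfM : ∀ t, |f t| ≤ M * |t|) (hM : 0 ≤ M) :
    Integrable (fun x => a x * |f (u x)| ^ m) := by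
  refine (hi.norm.const_mul (M ^ m)).mono' ?_ (Eventually.of_forall fun x => ?_)
  · refine ha.aestronglyMeasurable.mul ?_
    exact (continuous_abs.rpow_const fun _ => Or.inr hm).comp_aestronglyMeasurable
      (hf.comp_aestronglyMeasurable hum)
  · have h1 : |f (u x)| ^ m ≤ M ^ m * |u x| ^ m := by
      rw [← Real.mul_rpow hM (abs_nonneg _)]
      exact Real.rpow_le_rpow (abs_nonneg _) (hfM _) hm
    simp only [norm_mul, Real.norm_eq_abs, abs_of_nonneg (Real.rpow_nonneg (abs_nonneg _) m)]
    calc |a x| * |f (u x)| ^ m ≤ |a x| * (M ^ m * |u x| ^ m) := by gcongr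
      _ = _ := by ring

theorem MemE.comp {p q : ℝ} (hp : 0 ≤ p) (hq : 0 ≤ q) {a b : Space N → ℝ} (ha : Continuous a)
    (hb : Continuous b) {u : Space N → ℝ} (hu : MemE p q a b u) {f : ℝ → ℝ} (hf : ContDiff ℝ 1 f)
    {M : ℝ} (hM : ∀ t, |deriv f t| ≤ M) (hfM : ∀ t, |f t| ≤ M * |t|) :
    MemE p q a b (fun x => f (u x)) := by
  have hM0 : 0 ≤ M := (abs_nonneg _).trans (hM 0)
  exact ⟨hu.1.comp hf hM hfM, hu.2.1.comp hf hM hfM,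
    integrable_mul_rpow_comp hp ha hu.1.1.1 hu.2.2.1 hf.continuous hfM hM0,
    integrable_mul_rpow_comp hq hb hu.1.1.1 hu.2.2.2 hf.continuous hfM hM0⟩

/-- Energy estimate: testing the equation with a truncated power of the solution. -/
theorem IsWeakSolution.integral_truncPow_mul_le {p q : ℝ} (hp : 1 ≤ p) (hq : 0 ≤ q)
    {a b A B h : Space N → ℝ} {H : Space N → ℝ → ℝ} (ha : Continuous a) (hb : Continuous b)
    (hA : ∀ x, 0 ≤ A x) (hB : ∀ x, 0 ≤ B x) (hH : ∀ x s, |H x s| ≤ h x * |s| ^ (p - 1))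
    {v : Space N → ℝ} (hv : IsWeakSolution p q a b A B H v) {g : Space N → Space N}
    (hg : HasWeakGrad v g) (hgp : MemLp g (ENNReal.ofReal p)) {k α : ℝ} (hk : 0 ≤ k)
    (hα : 0 ≤ α) :
    ∫⁻ x, ENNReal.ofReal ((min |v x| k) ^ α * ‖g x‖ ^ p)
      ≤ ∫⁻ x, ‖h x‖ₑ * ‖v x‖ₑ ^ (α + p) := by
  have hp0 : 0 < p := by linarith
  obtain ⟨hvE, hsol⟩ := hv
  have hf := contDiff_truncPrim (k := k) hα
  have hder : ∀ t, |deriv (truncPrim k α) t| ≤ k ^ α := fun t => by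
    rw [deriv_truncPrim hα, abs_of_nonneg (truncPow_nonneg hk t)]
    exact truncPow_le hk hα t
  obtain ⟨-, -, -, heq⟩ := hsol _ (hvE.comp hp0.le hq ha hb hf hder (abs_truncPrim_le hk hα))
  specialize heq g _ hg (hg.comp hf hder)
  have hsame : ∀ m : ℝ, m ≠ 0 → ∀ x, ‖g x‖ ^ (m - 2) * inner ℝ (g x) (deriv (truncPrim k α) (v x) • g x)
      = (min |v x| k) ^ α * ‖g x‖ ^ m := by
    intro m hm x
    rw [inner_smul_right, deriv_truncPrim hα, real_inner_self_eq_norm_sq]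
    rcases (norm_nonneg (g x)).eq_or_lt with h1 | h1
    · simp [← h1, Real.zero_rpow hm]
    · rw [mul_left_comm, ← Real.rpow_natCast, ← Real.rpow_add h1]
      norm_num
  have hAn : 0 ≤ ∫ x, A x * (|v x| ^ (p - 2) * v x) * truncPrim k α (v x) :=
    integral_nonneg fun x => by
      have := mul_nonneg (mul_nonneg (hA x) (Real.rpow_nonneg (abs_nonneg (v x)) (p - 2)))
        (mul_truncPrim_nonneg (α := α) hk (v x))
      calc (0 : ℝ) ≤ _ := this
        _ = _ := by ring
  have hBn : 0 ≤ ∫ x, B x * (|v x| ^ (q - 2) * v x) * truncPrim k α (v x) :=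
    integral_nonneg fun x => by
      have := mul_nonneg (mul_nonneg (hB x) (Real.rpow_nonneg (abs_nonneg (v x)) (q - 2)))
        (mul_truncPrim_nonneg (α := α) hk (v x))
      calc (0 : ℝ) ≤ _ := this
        _ = _ := by ring
  -- The test function is nondecreasing in `v`, so the q-Laplacian contributes nonnegatively and
  -- only the p-energy is kept.
  have hqn : 0 ≤ ∫ x, ‖g x‖ ^ (q - 2) * inner ℝ (g x) (deriv (truncPrim k α) (v x) • g x) :=
    integral_nonneg fun x => by
      simp only [inner_smul_right, deriv_truncPrim hα, real_inner_self_eq_norm_sq]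
      exact mul_nonneg (Real.rpow_nonneg (norm_nonneg _) _)
        (mul_nonneg (truncPow_nonneg hk _) (sq_nonneg _))
  have hint : Integrable fun x => (min |v x| k) ^ α * ‖g x‖ ^ p := by
    have hgi : Integrable fun x => ‖g x‖ ^ p := by
      have := hgp.integrable_norm_rpow (by simpa using hp0) ENNReal.ofReal_ne_top
      rwa [ENNReal.toReal_ofReal hp0.le] at this
    refine hgi.bdd_mul (c := k ^ α)
      ((continuous_truncPow hα).comp_aestronglyMeasurable hvE.1.1.1)
      (Eventually.of_forall fun x => ?_)
    rw [Real.norm_of_nonneg (truncPow_nonneg hk _)]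
    exact truncPow_le hk hα _
  rw [← ofReal_integral_eq_lintegral_ofReal hint (Eventually.of_forall fun x =>
    mul_nonneg (truncPow_nonneg hk _) (Real.rpow_nonneg (norm_nonneg _) _))]
  have hle : ∫ x, (min |v x| k) ^ α * ‖g x‖ ^ p ≤ ∫ x, H x (v x) * truncPrim k α (v x) := by
    simp only [hsame p hp0.ne'] at heq
    linarith
  calc ENNReal.ofReal (∫ x, (min |v x| k) ^ α * ‖g x‖ ^ p)
      ≤ ENNReal.ofReal (∫ x, H x (v x) * truncPrim k α (v x)) := ENNReal.ofReal_le_ofReal hle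
    _ ≤ ‖∫ x, H x (v x) * truncPrim k α (v x)‖ₑ := by
        rw [← ofReal_norm]
        exact ENNReal.ofReal_le_ofReal (le_abs_self _)
    _ ≤ ∫⁻ x, ‖H x (v x) * truncPrim k α (v x)‖ₑ := enorm_integral_le_lintegral_enorm _
    _ ≤ ∫⁻ x, ‖h x‖ₑ * ‖v x‖ₑ ^ (α + p) := by
        refine lintegral_mono fun x => ?_
        have h0 : 0 ≤ α + p := by linarith
        rw [← ofReal_norm, ← ofReal_norm (h x), ← ofReal_norm (v x),
          ENNReal.ofReal_rpow_of_nonneg (norm_nonneg _) h0,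
          ← ENNReal.ofReal_mul (norm_nonneg _)]
        apply ENNReal.ofReal_le_ofReal
        simp only [Real.norm_eq_abs, abs_mul]
        have hpow : |v x| ^ (p - 1) * (|v x| ^ α * |v x|) = |v x| ^ (α + p) := by
          rcases (abs_nonneg (v x)).eq_or_lt with h1 | h1
          · rw [← h1, Real.zero_rpow (by linarith : α + p ≠ 0)]
            simp
          · rw [← Real.rpow_add_one h1.ne', ← Real.rpow_add h1]
            congr 1
            ring
        calc |H x (v x)| * |truncPrim k α (v x)|
            ≤ (h x * |v x| ^ (p - 1)) * (|v x| ^ α * |v x|) :=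
              mul_le_mul (hH x _) (abs_truncPrim_le_rpow hk hα _) (abs_nonneg _)
                ((abs_nonneg _).trans (hH x _))
          _ ≤ (|h x| * |v x| ^ (p - 1)) * (|v x| ^ α * |v x|) := by
              gcongr
              exact le_abs_self _
          _ = |h x| * |v x| ^ (α + p) := by rw [mul_assoc, hpow]

end PQLaplace

/-! ### The Moser iteration. -/

namespace PQLaplace

open Filter Topology Set
open scoped NNReal

variable {N : ℕ}

/-- One step of the Moser iteration. -/
theorem IsWeakSolution.eLpNorm_le_mul_eLpNorm {p q r : ℝ} (hp : 1 ≤ p) (hpN : p < N) (hq : 0 ≤ q)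
    (hr : 1 < r) {C : ℝ≥0}
    (hC : ∀ (u : Space N → ℝ) (g : Space N → Space N), HasWeakGrad u g →
      MemLp u (ENNReal.ofReal (critExp N p)) →
      eLpNorm u (ENNReal.ofReal (critExp N p)) volume ≤ C * eLpNorm g (ENNReal.ofReal p) volume)
    {a b A B h : Space N → ℝ} {H : Space N → ℝ → ℝ} (ha : Continuous a) (hb : Continuous b)
    (hA : ∀ x, 0 ≤ A x) (hB : ∀ x, 0 ≤ B x) (hH : ∀ x s, |H x s| ≤ h x * |s| ^ (p - 1))
    (hh : AEStronglyMeasurable h) {v : Space N → ℝ} (hv : IsWeakSolution p q a b A B H v)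
    {s : ℝ} (hs : 1 ≤ s) :
    eLpNorm v (ENNReal.ofReal (critExp N p * s)) volume
      ≤ (ENNReal.ofReal s * (C * eLpNorm h (ENNReal.ofReal r) volume ^ (1 / p))) ^ (1 / s)
        * eLpNorm v (ENNReal.ofReal (p * conjExp r * s)) volume := by
  have hp0 : 0 < p := by linarith
  have hs0 : 0 < s := by linarith
  have hs1 : 0 ≤ s - 1 := by linarith
  have hr0 : 0 < r := by linarith
  have hcrit := critExp_pos hp0 hpN
  have hconj : r.HolderConjugate (conjExp r) := Real.HolderConjugate.conjExponent hr
  have hr'0 : 0 < conjExp r := hconj.symm.pos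
  have hE := hv.1
  obtain ⟨hvL, g, hg, hgp⟩ := hE.1
  have hvm := hvL.1
  set D : ℝ≥0∞ := C * eLpNorm h (ENNReal.ofReal r) volume ^ (1 / p) with hD
  set Y := eLpNorm v (ENNReal.ofReal (p * conjExp r * s)) volume with hY
  have hf : ∀ k, ContDiff ℝ 1 (truncPrim k (s - 1)) := fun k => contDiff_truncPrim hs1
  have hholder : ∫⁻ x, ‖h x‖ₑ * ‖v x‖ₑ ^ (p * (s - 1) + p)
      ≤ eLpNorm h (ENNReal.ofReal r) volume * Y ^ (p * s) := by
    have h1 := ENNReal.lintegral_mul_le_Lp_mul_Lq volume hconj hh.enorm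
      (hvm.enorm.pow_const (p * (s - 1) + p))
    refine h1.trans (le_of_eq ?_)
    rw [hY, eLpNorm_eq_lintegral_rpow_enorm_toReal (by simpa using hr0) ENNReal.ofReal_ne_top,
      eLpNorm_eq_lintegral_rpow_enorm_toReal (p := ENNReal.ofReal (p * conjExp r * s))
        (by simp only [ne_eq, ENNReal.ofReal_eq_zero, not_le]; positivity) ENNReal.ofReal_ne_top,
      ENNReal.toReal_ofReal hr0.le, ENNReal.toReal_ofReal (by positivity), ← ENNReal.rpow_mul]
    congr 1
    congr 1
    · congr with x
      rw [← ENNReal.rpow_mul]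
      congr 1
      ring
    · field_simp
  have hstep : ∀ n : ℕ, eLpNorm (fun x => |truncPrim n (s - 1) (v x)|)
      (ENNReal.ofReal (critExp N p)) volume ≤ D * Y ^ s := by
    intro n
    have hn : (0 : ℝ) ≤ n := n.cast_nonneg
    have hder : ∀ t, |deriv (truncPrim n (s - 1)) t| ≤ (n : ℝ) ^ (s - 1) := fun t => by
      rw [deriv_truncPrim hs1, abs_of_nonneg (truncPow_nonneg hn t)]
      exact truncPow_le hn hs1 t
    have hw : HasWeakGrad (fun x => truncPrim n (s - 1) (v x)) _ := hg.comp (hf n) hder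
    have hL : MemLp (fun x => truncPrim n (s - 1) (v x)) (ENNReal.ofReal (critExp N p)) :=
      hvL.of_le_mul ((hf n).continuous.comp_aestronglyMeasurable hvm)
        (Eventually.of_forall fun x => abs_truncPrim_le hn hs1 _)
    -- The equation is tested at exponent p(s-1), while Sobolev is applied to the primitive at
    -- exponent s-1, whose gradient to the power p carries exactly this weight.
    have henergy := (hv.integral_truncPow_mul_le hp hq ha hb hA hB hH hg hgp hn
      (mul_nonneg hp0.le hs1)).trans hholder
    calc eLpNorm (fun x => |truncPrim n (s - 1) (v x)|) (ENNReal.ofReal (critExp N p)) volume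
        = eLpNorm (fun x => truncPrim n (s - 1) (v x)) (ENNReal.ofReal (critExp N p)) volume :=
          eLpNorm_norm (fun x => truncPrim n (s - 1) (v x))
      _ ≤ C * eLpNorm (fun x => deriv (truncPrim n (s - 1)) (v x) • g x)
            (ENNReal.ofReal p) volume := hC _ _ hw hL
      _ = C * (∫⁻ x, ENNReal.ofReal ((min |v x| n) ^ (p * (s - 1)) * ‖g x‖ ^ p)) ^ (1 / p) := by
          rw [eLpNorm_eq_lintegral_rpow_enorm_toReal (by simpa using hp0) ENNReal.ofReal_ne_top,
            ENNReal.toReal_ofReal hp0.le]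
          congr 2
          refine lintegral_congr fun x => ?_
          have hmin : 0 ≤ min |v x| (n : ℝ) := le_min (abs_nonneg _) hn
          rw [← ofReal_norm, ENNReal.ofReal_rpow_of_nonneg (norm_nonneg _) hp0.le, norm_smul,
            deriv_truncPrim hs1, Real.norm_of_nonneg (truncPow_nonneg hn _),
            Real.mul_rpow (truncPow_nonneg hn _) (norm_nonneg _), ← Real.rpow_mul hmin,
            mul_comm p]
      _ ≤ C * (eLpNorm h (ENNReal.ofReal r) volume * Y ^ (p * s)) ^ (1 / p) := by gcongr
      _ = D * Y ^ s := by
          rw [ENNReal.mul_rpow_of_nonneg _ _ (by positivity), ← ENNReal.rpow_mul, hD, mul_assoc (C : ℝ≥0∞)]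
          congr 3
          field_simp
  -- Fatou removes the truncation. The estimate lives in [0, ∞], so `Y` need not be finite.
  have hlim : eLpNorm (fun x => s⁻¹ * ‖v x‖ ^ s) (ENNReal.ofReal (critExp N p)) volume
      ≤ D * Y ^ s := by
    refine (Lp.eLpNorm_lim_le_liminf_eLpNorm (p := ENNReal.ofReal (critExp N p)) (μ := volume)
      (f := fun (n : ℕ) x => |truncPrim n (s - 1) (v x)|)
      (fun n => ((hf n).continuous.comp_aestronglyMeasurable hvm).norm) _
      (Eventually.of_forall fun x => ?_)).trans
      ((liminf_le_liminf (Eventually.of_forall hstep)).trans (by simp))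
    apply tendsto_const_nhds.congr'
    obtain ⟨m, hm⟩ := exists_nat_ge |v x|
    filter_upwards [eventually_ge_atTop m] with n hn
    rw [abs_truncPrim_of_le hs1 (hm.trans (by exact_mod_cast hn)), sub_add_cancel,
      Real.norm_eq_abs, div_eq_inv_mul]
  have hpow : eLpNorm v (ENNReal.ofReal (critExp N p * s)) volume ^ s
      ≤ ENNReal.ofReal s * D * Y ^ s := by
    rw [ENNReal.ofReal_mul hcrit.le, ← eLpNorm_norm_rpow v hs0, mul_assoc]
    calc eLpNorm (fun x => ‖v x‖ ^ s) (ENNReal.ofReal (critExp N p)) volume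
        = eLpNorm (s • fun x => s⁻¹ * ‖v x‖ ^ s) (ENNReal.ofReal (critExp N p)) volume := by
          congr 1
          funext x
          simp [hs0.ne']
      _ = ENNReal.ofReal s * eLpNorm (fun x => s⁻¹ * ‖v x‖ ^ s)
            (ENNReal.ofReal (critExp N p)) volume := by
          rw [eLpNorm_const_smul, Real.enorm_eq_ofReal hs0.le]
      _ ≤ _ := by gcongr
  have hroot := ENNReal.rpow_le_rpow hpow (by positivity : 0 ≤ 1 / s)
  rwa [← ENNReal.rpow_mul, mul_one_div_cancel hs0.ne', ENNReal.rpow_one,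
    ENNReal.mul_rpow_of_nonneg _ _ (by positivity), ← ENNReal.rpow_mul,
    mul_one_div_cancel hs0.ne', ENNReal.rpow_one] at hroot

/-- A bound on the `L^{t n}` norms along exponents `t n → ∞` is a bound on the `L^∞` norm. -/
theorem eLpNorm_top_le_of_forall_eLpNorm_le {α : Type*} [MeasurableSpace α] {μ : Measure α}
    {v : α → ℝ} (hv : AEStronglyMeasurable v μ) {t : ℕ → ℝ} (ht : ∀ n, 0 < t n)
    (hlim : Tendsto t atTop atTop) {M : ℝ≥0∞}
    (hM : ∀ n, eLpNorm v (ENNReal.ofReal (t n)) μ ≤ M) : eLpNorm v ⊤ μ ≤ M := by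
  refine le_of_forall_gt_imp_ge_of_dense fun l hl => ?_
  rcases eq_or_ne l ⊤ with rfl | hltop
  · exact le_top
  have hl0 : l ≠ 0 := (bot_le.trans_lt hl).ne'
  have hbase : l⁻¹ * M < 1 := by
    rw [← ENNReal.inv_mul_cancel hl0 hltop]
    exact (ENNReal.mul_lt_mul_iff_right (ENNReal.inv_ne_zero.2 hltop)
      (ENNReal.inv_ne_top.2 hl0)).2 hl
  -- Chebyshev's inequality at each exponent: for l > M the ratio M / l is below 1 and its powers
  -- tend to 0. No finiteness of `μ` is needed.
  have hbound : ∀ n, μ {x | l ≤ ‖v x‖ₑ} ≤ (l⁻¹ * M) ^ t n := fun n => by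
    have := meas_ge_le_mul_pow_eLpNorm_enorm μ (p := ENNReal.ofReal (t n)) (by simpa using ht n)
      ENNReal.ofReal_ne_top hv hl0 (fun h => absurd h hltop)
    rw [ENNReal.toReal_ofReal (ht n).le] at this
    rw [ENNReal.mul_rpow_of_nonneg _ _ (ht n).le]
    refine this.trans ?_
    gcongr
    · exact (ht n).le
    · exact hM n
  have hzero : μ {x | l ≤ ‖v x‖ₑ} = 0 := le_antisymm
    (ge_of_tendsto' ((ENNReal.tendsto_rpow_atTop_of_base_lt_one hbase).comp hlim) hbound)
    zero_le
  rw [eLpNorm_exponent_top]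
  refine essSup_le_of_ae_le _ ?_
  have : ∀ᵐ x ∂μ, ¬ l ≤ ‖v x‖ₑ := by
    rw [ae_iff]
    simpa using hzero
  filter_upwards [this] with x hx
  exact (not_le.1 hx).le

/-- The infinite product of the constants of a Moser iteration converges. -/
theorem le_exp_tsum_mul_of_le_rpow_mul {σ D : ℝ} (hσ : 1 < σ) (hD : 1 ≤ D) {X : ℕ → ℝ≥0∞}
    (hX : ∀ n, X (n + 1) ≤
      ENNReal.ofReal (σ ^ (n + 1) * D) ^ (1 / σ ^ (n + 1)) * X n) (n : ℕ) :
    X n ≤ ENNReal.ofReal (Real.exp (∑' j : ℕ, (j * Real.log σ + Real.log D) * σ⁻¹ ^ j)) * X 0 := by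
  have hσ0 : 0 < σ := by linarith
  have hD0 : 0 < D := by linarith
  -- The iteration uses only j ≥ 1; the extra term j = 0 is harmless because D ≥ 1 makes every term
  -- nonnegative.
  set c : ℕ → ℝ := fun j => (j * Real.log σ + Real.log D) * σ⁻¹ ^ j with hc
  have hc0 : ∀ j, 0 ≤ c j := fun j => by
    have := Real.log_nonneg hσ.le
    have := Real.log_nonneg hD
    positivity
  have hinv : ‖σ⁻¹‖ < 1 := by
    rw [norm_inv, Real.norm_of_nonneg hσ0.le]
    exact inv_lt_one_of_one_lt₀ hσ
  have hsum : Summable c := by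
    have h1 := (summable_pow_mul_geometric_of_norm_lt_one 1 hinv).mul_left (Real.log σ)
    have h2 := (summable_geometric_of_norm_lt_one hinv).mul_left (Real.log D)
    refine (h1.add h2).congr fun j => ?_
    simp only [hc]
    ring
  have hfac : ∀ j, ENNReal.ofReal (σ ^ j * D) ^ (1 / σ ^ j) = ENNReal.ofReal (Real.exp (c j)) := by
    intro j
    have hpos : 0 < σ ^ j * D := by positivity
    rw [ENNReal.ofReal_rpow_of_pos hpos, Real.rpow_def_of_pos hpos,
      Real.log_mul (by positivity) (by positivity), Real.log_pow, one_div, ← inv_pow]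
  have hpart : ∀ n, X n ≤ ENNReal.ofReal (Real.exp (∑ j ∈ Finset.range n, c (j + 1))) * X 0 := by
    intro n
    induction n with
    | zero => simp
    | succ n ih =>
      rw [Finset.sum_range_succ, add_comm (Finset.sum _ _), Real.exp_add, ENNReal.ofReal_mul (Real.exp_pos _).le,
        mul_assoc, ← hfac]
      exact (hX n).trans (by gcongr)
  refine (hpart n).trans ?_
  gcongr
  calc ∑ j ∈ Finset.range n, c (j + 1) ≤ ∑ j ∈ Finset.range (n + 1), c j := by
        rw [Finset.sum_range_succ']
        linarith [hc0 0]
    _ ≤ ∑' j, c j := hsum.sum_le_tsum _ fun j _ => hc0 j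

/-- This identity chains the steps: the exponent gained at one stage is the one required at the
next. -/
theorem critExp_eq_mul_sigma {p r : ℝ} (hp : 0 < p) (hr : 1 < r) :
    critExp N p = p * conjExp r * sigma N p r := by
  have : r - 1 ≠ 0 := by linarith
  have hr0 : r ≠ 0 := by linarith
  unfold sigma
  rw [mul_div_cancel₀]
  unfold conjExp
  positivity

/-- Clearing denominators, σ > 1 reduces to N < p r. -/
theorem one_lt_sigma {p r : ℝ} (hp : 0 < p) (hpN : p < N) (hr : 1 < r) (hpr : N < p * r) :
    1 < sigma N p r := by
  have h1 : 0 < (N : ℝ) - p := by linarith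
  have h2 : 0 < r - 1 := by linarith
  unfold sigma conjExp critExp
  rw [one_lt_div (by positivity), ← mul_div_assoc, div_lt_div_iff₀ h2 h1]
  nlinarith

end PQLaplace

/-! ### The bound on v. -/

theorem lemma3p2 (N : ℕ) (p q r : ℝ) (hq : 2 ≤ q) (hqp : q ≤ p) (hpN : p < (N : ℝ))
    (hr : (N : ℝ) < p * r) (η : ℝ) :
    ∃ M₁ : ℝ, 0 < M₁ ∧
      ∀ a b : PQLaplace.Space N → ℝ, Continuous a → Continuous b →
        (∀ x, 0 ≤ a x) → (∀ x, 0 ≤ b x) →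
      ∀ (H : PQLaplace.Space N → ℝ → ℝ) (h : PQLaplace.Space N → ℝ),
        Continuous (fun z : PQLaplace.Space N × ℝ => H z.1 z.2) →
        MemLp h (ENNReal.ofReal r) volume →
        (PQLaplace.lpNorm h r).toReal = η →
        (∀ x s, |H x s| ≤ h x * |s| ^ (p - 1)) →
      ∀ A B : PQLaplace.Space N → ℝ, (∀ x, 0 ≤ A x) → (∀ x, 0 ≤ B x) →
      ∀ v : PQLaplace.Space N → ℝ, PQLaplace.IsWeakSolution p q a b A B H v →
        MemLp v ⊤ volume ∧
        eLpNorm v ⊤ volume ≤ ENNReal.ofReal M₁ *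
          max (PQLaplace.lpNorm v (PQLaplace.critExp N p))
            (max (ENNReal.ofReal (PQLaplace.constK N p q r η))
              (max (ENNReal.ofReal (PQLaplace.constK N p q r η) * PQLaplace.constL p r v) 1)) := by
  open PQLaplace Filter in
  have hp1 : 1 ≤ p := by linarith
  have hp0 : 0 < p := by linarith
  have hr1 : 1 < r := by
    by_contra! hle
    nlinarith
  have hσ := one_lt_sigma hp0 hpN hr1 hr
  have hcrit := critExp_pos hp0 hpN
  obtain ⟨C, hC⟩ := exists_eLpNorm_le_eLpNorm_weakGrad hp1 hpN
  -- `C` is fixed before `h` and `v`, so `D` sees the data only through η; the maximum with 1 keeps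
  -- log D nonnegative.
  set D : ℝ := max 1 (C * η ^ (1 / p)) with hD
  set σ := sigma N p r with hσdef
  refine ⟨Real.exp (∑' j : ℕ, (j * Real.log σ + Real.log D) * σ⁻¹ ^ j), Real.exp_pos _, ?_⟩
  intro a b ha hb _ _ H h _ hh hη hH A B hA hB v hv
  have hη0 : 0 ≤ η := hη ▸ ENNReal.toReal_nonneg
  have hnorm : eLpNorm h (ENNReal.ofReal r) volume = ENNReal.ofReal η := by
    rw [← hη]
    exact (ENNReal.ofReal_toReal hh.2.ne).symm
  have hDle : C * eLpNorm h (ENNReal.ofReal r) volume ^ (1 / p) ≤ ENNReal.ofReal D := by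
    rw [hnorm, ENNReal.ofReal_rpow_of_nonneg hη0 (by positivity), ← ENNReal.ofReal_coe_nnreal,
      ← ENNReal.ofReal_mul C.coe_nonneg]
    exact ENNReal.ofReal_le_ofReal (le_max_right _ _)
  have hX := le_exp_tsum_mul_of_le_rpow_mul hσ (le_max_left 1 (C * η ^ (1 / p)))
    (X := fun n => eLpNorm v (ENNReal.ofReal (critExp N p * σ ^ n)) volume) (fun n => by
      have hs : 1 ≤ σ ^ (n + 1) := one_le_pow₀ hσ.le
      refine (hv.eLpNorm_le_mul_eLpNorm hp1 hpN (by linarith) hr1 hC ha hb hA hB hH hh.1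
        hs).trans ?_
      rw [show p * conjExp r * σ ^ (n + 1) = critExp N p * σ ^ n by
          rw [critExp_eq_mul_sigma hp0 hr1, ← hσdef]; ring,
        ENNReal.ofReal_mul (by positivity : 0 ≤ σ ^ (n + 1))]
      gcongr)
  simp only [pow_zero, mul_one] at hX
  have htop := eLpNorm_top_le_of_forall_eLpNorm_le hv.1.1.1.1
    (fun n => mul_pos hcrit (pow_pos (by linarith) n))
    ((tendsto_pow_atTop_atTop_of_one_lt hσ).const_mul_atTop hcrit) hX
  refine ⟨⟨hv.1.1.1.1, htop.trans_lt ?_⟩, htop.trans ?_⟩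
  · exact ENNReal.mul_lt_top ENNReal.ofReal_lt_top hv.1.1.1.2
  -- The iteration bounds by the L^(p*) norm alone, which is the first entry of the maximum.
  · gcongr
    exact le_max_left _ _
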